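/- Let $N$ be an odd prime, let $\eta(z)=q^{1/24}\prod_{n\ge1}(1-q^n)$, $q=e^{2\pi i z}$, be the Dedekind eta function on the upper half-plane $\mathcal H$, and let $\Delta=\eta^{24}$. Let $\mathcal S_{12}(\Gamma_0(N))$ be the space of weight $12$ cusp forms for $\Gamma_0(N)$, and let $w_N$ be the Atkin–Lehner involution on it, $(w_Nf)(z)=N^{-6}z^{-12}f(-1/(Nz))$, with $+1$-eigenspace $\mathcal S_{12}^+(\Gamma_0(N))$. Let $X_0^+(N)$ be the quotient of $\mathcal H\cup\mathbb P^1(\mathbb Q)$ by the group generated by $\Gamma_0(N)$ and the involution $z\mapsto -1/(Nz)$. 1. One has $w_N(\Delta)(z)=N^6\Delta(Nz)=N^6\eta(Nz)^{24}$, and the continuous functions $g$ on $\mathcal H$ with $g^2=\Delta\cdot w_N(\Delta)$ are exactly $g=\pm N^3\,\eta(z)^{12}\eta(Nz)^{12}$. Thus, up to a nonzero constant factor, $\sqrt{\Delta\cdot w_N(\Delta)}=\eta(z)^{12}\eta(Nz)^{12}$. 2. The function $\eta(z)^{12}\eta(Nz)^{12}$ is a weight $12$ cusp form for $\Gamma_0(N)$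 lying in $\mathcal S_{12}^+(\Gamma_0(N))$. 3. The curve $X_0^+(N)$ has exactly one cusp, $\infty$, and the form $\eta(z)^{12}\eta(Nz)^{12}$ vanishes at a point of $X_0^+(N)$ if and only if that point is the cusp $\infty$. -/

import Mathlib

open scoped UpperHalfPlane MatrixGroups ModularForm OnePoint

noncomputable section

/-- The matrix `N^(-1/2) * (0, -1; N, 0)`, of determinant `1`. It acts on the upper half-plane as
the Fricke involution `z ↦ -1 / (N z)`, which for prime `N` is the Atkin-Lehner involution. -/
def atkinLehnerMatrix (N : ℕ) [NeZero N] : GL (Fin 2) ℝ :=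
  Matrix.GeneralLinearGroup.mkOfDetNeZero !![0, -1 / √(N : ℝ); √(N : ℝ), 0] (by
    have : √(N : ℝ) ≠ 0 := (Real.sqrt_pos.2 (by exact_mod_cast Nat.pos_of_neZero N)).ne'
    simp [Matrix.det_fin_two, this])

/-- The group `Γ₀(N)`, viewed inside `GL(2, ℝ)`. -/
abbrev Gamma0GL (N : ℕ) : Subgroup (GL (Fin 2) ℝ) :=
  (CongruenceSubgroup.Gamma0 N).map (Matrix.SpecialLinearGroup.mapGL ℝ)

lemma atkinLehnerMatrix_conj_mem (N : ℕ) [NeZero N] {γ : GL (Fin 2) ℝ} (hγ : γ ∈ Gamma0GL N) :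
    atkinLehnerMatrix N * γ * (atkinLehnerMatrix N)⁻¹ ∈ Gamma0GL N := by
  obtain ⟨g, hg, rfl⟩ := hγ
  have hs : √(N : ℝ) ≠ 0 := (Real.sqrt_pos.2 (by exact_mod_cast Nat.pos_of_neZero N)).ne'
  have hss : √(N : ℝ) ^ 2 = N := Real.sq_sqrt (Nat.cast_nonneg N)
  have hg' : ((g 1 0 : ℤ) : ZMod N) = 0 := hg
  obtain ⟨c, hc⟩ := (ZMod.intCast_zmod_eq_zero_iff_dvd _ N).1 hg'
  have hdet := g.det_coe
  rw [Matrix.det_fin_two] at hdet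
  obtain ⟨h, hh⟩ : ∃ h : SL(2, ℤ), h.1 = !![g 1 1, -c; -(N * g 0 1), g 0 0] := by
    refine ⟨⟨!![g 1 1, -c; -(N * g 0 1), g 0 0], ?_⟩, rfl⟩
    rw [Matrix.det_fin_two]
    simp only [Matrix.of_apply, Matrix.cons_val', Matrix.cons_val_zero, Matrix.cons_val_one,
      Matrix.cons_val_fin_one]
    linear_combination hdet + g 0 1 * hc
  refine ⟨h, ?_, ?_⟩
  · change ((h.1 1 0 : ℤ) : ZMod N) = 0
    simp [hh]
  · rw [eq_mul_inv_iff_mul_eq]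
    ext i j
    have hcR : ((g 1 0 : ℤ) : ℝ) = N * c := by rw [hc]; push_cast; ring
    fin_cases i <;> fin_cases j <;>
      simp [atkinLehnerMatrix, Matrix.mul_apply, Fin.sum_univ_two, hh, hcR] <;>
      field_simp <;> (try rw [hss]) <;> rw [mul_comm]

lemma atkinLehnerMatrix_mul_self (N : ℕ) [NeZero N] :
    atkinLehnerMatrix N * atkinLehnerMatrix N = -1 := by
  have hs : √(N : ℝ) ≠ 0 := (Real.sqrt_pos.2 (by exact_mod_cast Nat.pos_of_neZero N)).ne'
  ext i j
  fin_cases i <;> fin_cases j <;>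
    simp [atkinLehnerMatrix, Matrix.mul_apply, Fin.sum_univ_two, hs, mul_div_cancel₀]

open ConjAct Pointwise in
/-- The matrix `atkinLehnerMatrix N` normalizes `Γ₀(N)`. -/
lemma atkinLehnerMatrix_conj (N : ℕ) [NeZero N] :
    Gamma0GL N = toConjAct (atkinLehnerMatrix N)⁻¹ • Gamma0GL N := by
  ext γ
  rw [Subgroup.mem_pointwise_smul_iff_inv_smul_mem, ← toConjAct_inv, toConjAct_smul, inv_inv]
  refine ⟨atkinLehnerMatrix_conj_mem N, fun h ↦ ?_⟩
  have h2 := atkinLehnerMatrix_conj_mem N h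
  have hW : (atkinLehnerMatrix N)⁻¹ = -atkinLehnerMatrix N := by
    rw [inv_eq_iff_mul_eq_one, mul_neg, atkinLehnerMatrix_mul_self, neg_neg]
  have : atkinLehnerMatrix N * (atkinLehnerMatrix N * γ * (atkinLehnerMatrix N)⁻¹) *
      (atkinLehnerMatrix N)⁻¹ = γ := by
    rw [show atkinLehnerMatrix N * (atkinLehnerMatrix N * γ * (atkinLehnerMatrix N)⁻¹) *
      (atkinLehnerMatrix N)⁻¹ = (atkinLehnerMatrix N * atkinLehnerMatrix N) * γ *
        ((atkinLehnerMatrix N)⁻¹ * (atkinLehnerMatrix N)⁻¹) by group, hW, neg_mul_neg,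
      atkinLehnerMatrix_mul_self]
    simp
  rwa [this] at h2

/-- The Atkin-Lehner (Fricke) operator `w_N` on the space `S_k(Γ₀(N))`:
`(w_N f)(z) = N^(-k/2) * z^(-k) * f(-1 / (N z))`. -/
def atkinLehner (N : ℕ) [NeZero N] (k : ℤ) : Module.End ℂ (CuspForm (Gamma0GL N) k) where
  toFun f := (CuspForm.translate f (atkinLehnerMatrix N)).mcast rfl (atkinLehnerMatrix_conj N)
  map_add' f g := by
    ext z
    exact congrFun (SlashAction.add_slash k (atkinLehnerMatrix N) ⇑f ⇑g) z
  map_smul' c f := by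
    ext z
    have h := ModularForm.smul_slash k (atkinLehnerMatrix N) ⇑f c
    have hdet : 0 < (atkinLehnerMatrix N).det.val := by
      have hs : √(N : ℝ) ≠ 0 := (Real.sqrt_pos.2 (by exact_mod_cast Nat.pos_of_neZero N)).ne'
      simp [atkinLehnerMatrix, Matrix.det_fin_two, hs]
    rw [UpperHalfPlane.σ, if_pos hdet] at h
    exact congrFun h z

/-- The space `S_k⁺(Γ₀(N))`: the `+1`-eigenspace of `w_N` on `S_k(Γ₀(N))`. -/
def plusCuspForms (N : ℕ) [NeZero N] (k : ℤ) : Submodule ℂ (CuspForm (Gamma0GL N) k) :=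
  (atkinLehner N k).eigenspace 1

/-- The discriminant cusp form `Δ`, viewed in `S_12(Γ₀(N))`. -/
def discriminantGamma0 (N : ℕ) [NeZero N] : CuspForm (Gamma0GL N) 12 where
  toFun := CuspForm.discriminant
  slash_action_eq' A hA := by
    obtain ⟨g, -, rfl⟩ := hA
    exact CuspForm.discriminant.slash_action_eq' _ ⟨g, rfl⟩
  holo' := CuspForm.discriminant.holo'
  zero_at_cusps' hc := CuspForm.discriminant.zero_at_cusps' <| hc.mono <| by
    rintro _ ⟨g, -, rfl⟩
    exact ⟨g, rfl⟩

/-- The function `η(z)^12 * η(N z)^12` on the upper half-plane. -/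
def etaProduct (N : ℕ) (z : ℍ) : ℂ :=
  ModularForm.eta z ^ 12 * ModularForm.eta (N * z) ^ 12

/-- The group generated by `Γ₀(N)` and the Atkin-Lehner involution. -/
def Gamma0Plus (N : ℕ) [NeZero N] : Subgroup (GL (Fin 2) ℝ) :=
  Gamma0GL N ⊔ Subgroup.zpowers (atkinLehnerMatrix N)

/-- The extended upper half-plane `ℍ ∪ ℙ¹(ℚ)`. -/
abbrev ExtendedUpperHalfPlane : Type := ℍ ⊕ OnePoint ℚ

/-- Two points of `ℍ ∪ ℙ¹(ℚ)` are equivalent if they lie in the same orbit of the group generated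
by `Γ₀(N)` and the Atkin-Lehner involution, acting by Möbius transformations
(on `ℙ¹(ℚ)`, seen inside `ℙ¹(ℝ)`). -/
def X0PlusSetoid (N : ℕ) [NeZero N] : Setoid ExtendedUpperHalfPlane :=
  (MulAction.orbitRel (Gamma0Plus N) (ℍ ⊕ OnePoint ℝ)).comap
    (Sum.map id (OnePoint.map ((↑) : ℚ → ℝ)))

/-- The points of `X₀⁺(N)(ℂ)`, the quotient of `X₀(N)` by the Atkin-Lehner involution. -/
def X0Plus (N : ℕ) [NeZero N] : Type := Quotient (X0PlusSetoid N)

/-- The point of `X₀⁺(N)` represented by a point of `ℍ ∪ ℙ¹(ℚ)`. -/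
def X0Plus.mk (N : ℕ) [NeZero N] (p : ExtendedUpperHalfPlane) : X0Plus N :=
  Quotient.mk (X0PlusSetoid N) p

/-- The cusp `∞` of `X₀⁺(N)`. -/
def X0Plus.infty (N : ℕ) [NeZero N] : X0Plus N := X0Plus.mk N (Sum.inr ∞)

/-- Vanishing of a form `f` of weight `k` at a point of `ℍ ∪ ℙ¹(ℚ)`: the value at a point of `ℍ`,
and at a cusp `c` the limit at `i∞` of the transforms of `f` by the matrices taking `∞` to `c`. -/
def VanishesAt (f : ℍ → ℂ) (k : ℤ) : ExtendedUpperHalfPlane → Prop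
  | Sum.inl z => f z = 0
  | Sum.inr c => (OnePoint.map ((↑) : ℚ → ℝ) c).IsZeroAt f k

end

/-! The form `η ^ 12` has weight 6 on `SL(2, ℤ)` with a quadratic character: the sign on `SL(2, 𝔽₂)
≃ S₃` (`etaPowTwelve_slash`). For odd `N`, replacing `z` by `N z` conjugates an element of `Γ₀(N)`
to a matrix with the same reduction modulo 2, so the two characters in `η(z)^12 η(Nz)^12` cancel
(`etaProduct_slash`). The Fricke involution swaps the two factors, and its two signs cancel as well.

Up to the factor `N ^ 6`, the square of the product is `Δ · w_N(Δ)`. Hence it vanishes at every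
cusp, while it has no zero on `ℍ` because `η` has none; as `ℍ` is connected, the continuous square
roots differ only by a sign. For prime `N`, the two `Γ₀(N)`-classes of cusps, those of `∞` and `0`,
are exchanged by the involution. -/

namespace ModularForm

open Complex
open UpperHalfPlane hiding I

/-! ### The quadratic character of `SL(2, ℤ)` and the transformation of `η ^ 12` -/

/-- The sign of a matrix of `SL(2, 𝔽₂) ≃ S₃`, as a function of its entries. -/
def signModTwo (a b c d : ZMod 2) : ℤ := if a + d = 1 ∨ (b = 0 ∧ c = 0) then 1 else -1

/-- In determinant 1 over `𝔽₂`, trace 1 singles out the elements of order 3 and `b = c = 0` the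
identity; the remaining matrices are the three transpositions. -/
lemma signModTwo_mul : ∀ a b c d a' b' c' d' : ZMod 2, a * d - b * c = 1 → a' * d' - b' * c' = 1 →
    signModTwo (a * a' + b * c') (a * b' + b * d') (c * a' + d * c') (c * b' + d * d') =
      signModTwo a b c d * signModTwo a' b' c' d' := by
  decide

lemma signModTwo_mul_self : ∀ a b c d : ZMod 2, signModTwo a b c d * signModTwo a b c d = 1 := by
  decide

lemma signModTwo_inv : ∀ a b c d : ZMod 2, signModTwo d (-b) (-c) a = signModTwo a b c d := by
  decide

/-- The quadratic character of `SL(2, ℤ)`: the sign of the reduction modulo `2`. -/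
def quadraticSign (γ : SL(2, ℤ)) : ℤ :=
  signModTwo (γ 0 0 : ℤ) (γ 0 1 : ℤ) (γ 1 0 : ℤ) (γ 1 1 : ℤ)

lemma det_intCast_zmod_two (γ : SL(2, ℤ)) :
    ((γ 0 0 : ℤ) : ZMod 2) * (γ 1 1 : ℤ) - (γ 0 1 : ℤ) * (γ 1 0 : ℤ) = 1 := by
  have h := γ.det_coe
  rw [Matrix.det_fin_two] at h
  exact_mod_cast congrArg (Int.cast : ℤ → ZMod 2) h

lemma quadraticSign_mul (γ δ : SL(2, ℤ)) :
    quadraticSign (γ * δ) = quadraticSign γ * quadraticSign δ := by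
  rw [quadraticSign, quadraticSign, quadraticSign,
    ← signModTwo_mul _ _ _ _ _ _ _ _ (det_intCast_zmod_two γ) (det_intCast_zmod_two δ)]
  simp [Matrix.mul_apply, Fin.sum_univ_two]

lemma quadraticSign_inv (γ : SL(2, ℤ)) : quadraticSign γ⁻¹ = quadraticSign γ := by
  rw [quadraticSign, quadraticSign, ← signModTwo_inv]
  simp [Matrix.SpecialLinearGroup.SL2_inv_expl]

lemma quadraticSign_mul_self (γ : SL(2, ℤ)) : quadraticSign γ * quadraticSign γ = 1 :=
  signModTwo_mul_self _ _ _ _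

/-- The function `η ^ 12` on the upper half-plane. -/
noncomputable def etaPowTwelve (z : ℍ) : ℂ := eta z ^ 12

lemma eta_neg_inv_pow_twelve (z : ℍ) : eta (-(z : ℂ)⁻¹) ^ 12 = -(z : ℂ) ^ 6 * eta z ^ 12 := by
  have he : eta (-(z : ℂ)⁻¹) = (sqrt I)⁻¹ * (sqrt z * eta z) := by
    simpa [neg_div] using eta_comp_eq_csqrt_I_inv z.2
  -- Only even powers of the square roots occur, so the choice of branch is irrelevant.
  have h (w : ℂ) (hw : w ≠ 0) : sqrt w ^ 12 = w ^ 6 := by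
    have : sqrt w ^ 2 = w := by simp [sqrt, ← Complex.cpow_nat_mul]
    rw [show 12 = 2 * 6 by norm_num, pow_mul, this]
  rw [he, mul_pow, mul_pow, inv_pow, h _ I_ne_zero, h _ (ne_zero z),
    show (I : ℂ) ^ 6 = -1 by rw [show 6 = 2 * 3 by norm_num, pow_mul, I_sq]; norm_num]
  norm_num

/-- The factor `q^(1/24)` picks up `exp (2πi/24)`, whose twelfth power is `-1`; the infinite product
depends on `q` alone. -/
lemma eta_add_one_pow_twelve (z : ℂ) : eta (1 + z) ^ 12 = -eta z ^ 12 := by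
  have h1 : Function.Periodic.qParam 1 (1 + z) = Function.Periodic.qParam 1 z := by
    simp [Function.Periodic.qParam, mul_add, Complex.exp_add]
  have h2 : Function.Periodic.qParam 24 (1 + z) ^ 12 = -Function.Periodic.qParam 24 z ^ 12 := by
    simp only [Function.Periodic.qParam, ← Complex.exp_nat_mul]
    rw [← neg_one_mul, ← Complex.exp_pi_mul_I, ← Complex.exp_add]
    congr 1
    push_cast
    ring
  simp only [eta, mul_pow, eta_q, h1, h2]
  ring

lemma etaPowTwelve_slash_S :
    etaPowTwelve ∣[(6 : ℤ)] ModularGroup.S = quadraticSign ModularGroup.S • etaPowTwelve := by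
  ext z
  rw [SL_slash_apply, modular_S_smul]
  have : quadraticSign ModularGroup.S = -1 := by decide
  have hz := ne_zero z
  simp only [etaPowTwelve, ModularGroup.denom_S, Pi.smul_apply, this]
  rw [UpperHalfPlane.coe_mk, inv_neg, eta_neg_inv_pow_twelve]
  simp [zpow_neg]
  field_simp

lemma etaPowTwelve_slash_T :
    etaPowTwelve ∣[(6 : ℤ)] ModularGroup.T = quadraticSign ModularGroup.T • etaPowTwelve := by
  ext z
  rw [SL_slash_apply, modular_T_smul]
  have : quadraticSign ModularGroup.T = -1 := by decide
  rw [this, ModularGroup.denom_apply]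
  simp [etaPowTwelve, eta_add_one_pow_twelve, ModularGroup.T]

/-- `η ^ 12` is a form of weight `6` on `SL(2, ℤ)` with character `quadraticSign`. -/
lemma etaPowTwelve_slash (γ : SL(2, ℤ)) :
    etaPowTwelve ∣[(6 : ℤ)] γ = quadraticSign γ • etaPowTwelve := by
  have hγ : γ ∈ Subgroup.closure {ModularGroup.S, ModularGroup.T} := by
    simp [SpecialLinearGroup.SL2Z_generators]
  induction hγ using Subgroup.closure_induction with
  | mem x hx =>
    rcases hx with rfl | rfl
    exacts [etaPowTwelve_slash_S, etaPowTwelve_slash_T]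
  | one =>
    have : quadraticSign 1 = 1 := by decide
    simp [this]
  | mul x y _ _ hx hy =>
    rw [SlashAction.slash_mul, hx, SL_smul_slash, hy, smul_smul, quadraticSign_mul]
  | inv x _ hx =>
    -- Slashing the relation for `x` by `x⁻¹` and using that the sign squares to 1 gives the
    -- relation for `x⁻¹`.
    have h := congrArg (· ∣[(6 : ℤ)] x⁻¹) hx
    simp only [← SlashAction.slash_mul, mul_inv_cancel, SlashAction.slash_one,
      SL_smul_slash] at h
    nth_rw 2 [h]
    rw [smul_smul, quadraticSign_inv, quadraticSign_mul_self, one_smul]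

lemma eta_smul_pow_twelve (γ : SL(2, ℤ)) (z : ℍ) :
    eta ↑(γ • z) ^ 12 = quadraticSign γ * denom γ z ^ 6 * eta z ^ 12 := by
  have h := congrFun (etaPowTwelve_slash γ) z
  rw [SL_slash_apply, zpow_neg, ← div_eq_mul_inv,
    div_eq_iff (zpow_ne_zero _ (denom_ne_zero _ z))] at h
  simp only [etaPowTwelve, Pi.smul_apply, zsmul_eq_mul] at h
  rw [h, zpow_ofNat]
  ring

end ModularForm

open UpperHalfPlane hiding I
open ModularForm
open scoped Manifold

/-- The point `N z` of the upper half-plane. -/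
noncomputable def natMul (N : ℕ) [NeZero N] (z : ℍ) : ℍ :=
  ⟨N * z, by
    have : (0 : ℝ) < N := by exact_mod_cast Nat.pos_of_neZero N
    simpa using mul_pos this z.im_pos⟩

@[simp]
lemma coe_natMul (N : ℕ) [NeZero N] (z : ℍ) : (natMul N z : ℂ) = N * z := rfl

lemma coe_sqrt_natCast_sq (N : ℕ) : ((√(N : ℝ) : ℝ) : ℂ) ^ 2 = N := by
  exact_mod_cast Real.sq_sqrt (Nat.cast_nonneg N)

/-! ### The Fricke involution -/

section Fricke

variable (N : ℕ) [NeZero N]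

lemma sqrt_natCast_ne_zero : √(N : ℝ) ≠ 0 :=
  (Real.sqrt_pos.2 (by exact_mod_cast Nat.pos_of_neZero N)).ne'

lemma det_atkinLehnerMatrix : (atkinLehnerMatrix N).det.val = 1 := by
  simp [atkinLehnerMatrix, Matrix.det_fin_two, sqrt_natCast_ne_zero N]

lemma coe_sqrt_natCast_ne_zero : ((√(N : ℝ) : ℝ) : ℂ) ≠ 0 := by
  exact_mod_cast sqrt_natCast_ne_zero N

lemma denom_atkinLehnerMatrix (z : ℂ) : denom (atkinLehnerMatrix N) z = √(N : ℝ) * z := by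
  simp [denom, atkinLehnerMatrix]

lemma coe_atkinLehnerMatrix_smul (z : ℍ) :
    ((atkinLehnerMatrix N • z : ℍ) : ℂ) = -(N * (z : ℂ))⁻¹ := by
  have h2 := coe_sqrt_natCast_sq N
  have h := coe_sqrt_natCast_ne_zero N
  have hz := z.ne_zero
  rw [coe_smul_of_det_pos (by rw [det_atkinLehnerMatrix]; exact one_pos), denom_atkinLehnerMatrix, ← h2]
  simp [num, atkinLehnerMatrix]
  field_simp

lemma slash_atkinLehnerMatrix_apply (f : ℍ → ℂ) (z : ℍ) :
    (f ∣[(12 : ℤ)] atkinLehnerMatrix N) z =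
      f (atkinLehnerMatrix N • z) / (N ^ 6 * (z : ℂ) ^ 12) := by
  rw [slash_apply, det_atkinLehnerMatrix, denom_atkinLehnerMatrix,
    σ, if_pos (by rw [det_atkinLehnerMatrix]; exact one_pos), ← coe_sqrt_natCast_sq N, zpow_neg, zpow_ofNat,
    div_eq_mul_inv]
  simp only [ContinuousAlgEquiv.refl_apply, abs_one, Complex.ofReal_one, one_zpow]
  ring

lemma eta_atkinLehnerMatrix_smul (z : ℍ) :
    eta ↑(atkinLehnerMatrix N • z) ^ 12 = -(N * (z : ℂ)) ^ 6 * eta (N * z) ^ 12 := by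
  rw [coe_atkinLehnerMatrix_smul]
  exact eta_neg_inv_pow_twelve (natMul N z)

lemma eta_natCast_mul_atkinLehnerMatrix_smul (z : ℍ) :
    eta (N * ↑(atkinLehnerMatrix N • z)) ^ 12 = -(z : ℂ) ^ 6 * eta z ^ 12 := by
  have h : (N : ℂ) ≠ 0 := by exact_mod_cast NeZero.ne N
  rw [coe_atkinLehnerMatrix_smul, ← eta_neg_inv_pow_twelve]
  congr 2
  field_simp

lemma etaProduct_slash_atkinLehnerMatrix :
    etaProduct N ∣[(12 : ℤ)] atkinLehnerMatrix N = etaProduct N := by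
  ext z
  have h : (N : ℂ) ≠ 0 := by exact_mod_cast NeZero.ne N
  have hz := z.ne_zero
  rw [slash_atkinLehnerMatrix_apply, etaProduct, etaProduct, eta_atkinLehnerMatrix_smul,
    eta_natCast_mul_atkinLehnerMatrix_smul]
  field_simp

lemma atkinLehner_discriminantGamma0_apply (z : ℍ) :
    atkinLehner N 12 (discriminantGamma0 N) z = (N : ℂ) ^ 6 * eta (N * z) ^ 24 := by
  change (ModularForm.discriminant ∣[(12 : ℤ)] atkinLehnerMatrix N) z = _
  have h : (N : ℂ) ≠ 0 := by exact_mod_cast NeZero.ne N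
  have hz := z.ne_zero
  rw [slash_atkinLehnerMatrix_apply, ModularForm.discriminant, show 24 = 12 * 2 by norm_num,
    pow_mul, pow_mul, eta_atkinLehnerMatrix_smul]
  field_simp

end Fricke

/-! ### Modularity under `Γ₀(N)`, zeros and square roots -/

section Gamma0

variable {N : ℕ}

/-- One has `N (γ z) = δ (N z)` with `δ` the conjugate of `γ` by `diag(N, 1)`. It is integral as `N`
divides the lower left entry, and congruent to `γ` modulo 2 as `N` is odd. -/
lemma eta_natCast_mul_smul_pow_twelve [NeZero N] (hN : Odd N) {γ : SL(2, ℤ)}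
    (hγ : γ ∈ CongruenceSubgroup.Gamma0 N) (z : ℍ) :
    eta (N * ↑(γ • z)) ^ 12 = quadraticSign γ * denom γ z ^ 6 * eta (N * z) ^ 12 := by
  obtain ⟨c, hc⟩ := (ZMod.intCast_zmod_eq_zero_iff_dvd _ N).1 hγ
  have hdet := γ.det_coe
  rw [Matrix.det_fin_two] at hdet
  have hN2 : ((N : ℤ) : ZMod 2) = 1 := by
    exact_mod_cast (ZMod.natCast_eq_one_iff_odd).2 hN
  obtain ⟨δ, hδ⟩ : ∃ δ : SL(2, ℤ), δ.1 = !![γ 0 0, N * γ 0 1; c, γ 1 1] := by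
    refine ⟨⟨!![γ 0 0, N * γ 0 1; c, γ 1 1], ?_⟩, rfl⟩
    rw [Matrix.det_fin_two]
    simp only [Matrix.of_apply, Matrix.cons_val', Matrix.cons_val_zero, Matrix.cons_val_one,
      Matrix.cons_val_fin_one]
    linear_combination hdet + γ 0 1 * hc
  have hsign : quadraticSign δ = quadraticSign γ := by
    simp [quadraticSign, hc, hδ, hN2, -Int.cast_natCast]
  have hden : denom δ (natMul N z) = denom γ z := by
    rw [ModularGroup.denom_apply, ModularGroup.denom_apply]
    simp [hδ, hc]
    ring
  have hsmul : ((δ • natMul N z : ℍ) : ℂ) = N * ↑(γ • z) := by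
    rw [ModularGroup.sl_moeb, ModularGroup.sl_moeb, coe_smul_of_det_pos (by simp),
      coe_smul_of_det_pos (by simp), hden]
    simp [num, hδ]
    ring
  rw [← hsmul, eta_smul_pow_twelve, hsign, hden, coe_natMul]

lemma etaProduct_slash [NeZero N] (hN : Odd N) {γ : SL(2, ℤ)}
    (hγ : γ ∈ CongruenceSubgroup.Gamma0 N) : etaProduct N ∣[(12 : ℤ)] γ = etaProduct N := by
  ext z
  have hs : (quadraticSign γ : ℂ) * quadraticSign γ = 1 := by
    exact_mod_cast quadraticSign_mul_self γ
  rw [SL_slash_apply, zpow_neg, ← div_eq_mul_inv,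
    div_eq_iff (zpow_ne_zero _ (denom_ne_zero _ z)), zpow_ofNat, etaProduct, etaProduct,
    eta_smul_pow_twelve, eta_natCast_mul_smul_pow_twelve hN hγ]
  linear_combination (eta z ^ 12 * eta (N * z) ^ 12 * denom γ z ^ 12) * hs

lemma etaProduct_ne_zero [NeZero N] (z : ℍ) : etaProduct N z ≠ 0 :=
  mul_ne_zero (pow_ne_zero _ (eta_ne_zero z.2)) (pow_ne_zero _ (eta_ne_zero (natMul N z).2))

lemma sq_natCast_mul_etaProduct [NeZero N] (z : ℍ) : ((N : ℂ) ^ 3 * etaProduct N z) ^ 2 =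
    discriminantGamma0 N z * atkinLehner N 12 (discriminantGamma0 N) z := by
  rw [atkinLehner_discriminantGamma0_apply]
  change _ = eta z ^ 24 * _
  rw [etaProduct]
  ring

lemma mdifferentiable_etaProduct [NeZero N] : MDiff (etaProduct N) := by
  rw [UpperHalfPlane.mdifferentiable_iff]
  intro z hz
  have h1 := differentiableAt_eta_of_mem_upperHalfPlaneSet hz
  have h2 : DifferentiableAt ℂ (fun w : ℂ ↦ eta (N * w)) z :=
    (differentiableAt_eta_of_mem_upperHalfPlaneSet (natMul N ⟨z, hz⟩).2).comp z
      (differentiableAt_id.const_mul (N : ℂ))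
  refine DifferentiableWithinAt.congr ((h1.pow 12).mul (h2.pow 12)).differentiableWithinAt
    (fun w hw ↦ ?_) ?_
  · simp [etaProduct, ofComplex_apply_of_im_pos hw]
  · simp [etaProduct, ofComplex_apply_of_im_pos hz]

lemma isZeroAtImInfty_of_sq {f : ℍ → ℂ} (hf : IsZeroAtImInfty (f * f)) : IsZeroAtImInfty f := by
  rw [IsZeroAtImInfty, Filter.ZeroAtFilter, tendsto_zero_iff_norm_tendsto_zero] at hf ⊢
  simpa [Real.sqrt_mul_self] using hf.sqrt

/-- Passing to the square reduces the claim to the cusp forms `Δ` and `w_N(Δ)`, with no expansion of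
`η` at the cusps. -/
lemma isZeroAt_etaProduct [NeZero N] {c : OnePoint ℝ} (hc : IsCusp c (Gamma0GL N)) :
    c.IsZeroAt (etaProduct N) 12 := by
  intro g hg
  have h1 := (discriminantGamma0 N).zero_at_cusps' hc g hg
  have h2 := (atkinLehner N 12 (discriminantGamma0 N)).zero_at_cusps' hc g hg
  refine isZeroAtImInfty_of_sq ?_
  have h : (N : ℂ) ≠ 0 := by exact_mod_cast NeZero.ne N
  have h3 : (fun z ↦ ((N : ℂ) ^ 6)⁻¹ * ((⇑(discriminantGamma0 N) ∣[(12 : ℤ)] g) z *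
      (⇑(atkinLehner N 12 (discriminantGamma0 N)) ∣[(12 : ℤ)] g) z)) =
      (etaProduct N ∣[(12 : ℤ)] g) * (etaProduct N ∣[(12 : ℤ)] g) := by
    ext z
    -- The matrix `g` may have negative determinant, in which case the slash action conjugates
    -- values; hence `σ g`.
    have h4 := congrArg (σ g) (sq_natCast_mul_etaProduct (N := N) (g • z))
    simp only [map_mul, map_pow, map_natCast] at h4
    rw [inv_mul_eq_iff_eq_mul₀ (pow_ne_zero _ h)]
    simp only [slash_apply, Pi.mul_apply]
    linear_combination (-(|g.det.val| ^ (12 - 1 : ℤ) * denom g z ^ (-12 : ℤ)) ^ 2 : ℂ) * h4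
  rw [← h3]
  simpa [IsZeroAtImInfty, Filter.ZeroAtFilter] using! (h1.mul h2).const_mul ((N : ℂ) ^ 6)⁻¹

end Gamma0

lemma isCusp_gamma0GL_iff {N : ℕ} [NeZero N] {c : OnePoint ℝ} :
    IsCusp c (Gamma0GL N) ↔ c ∈ Set.range (OnePoint.map ((↑) : ℚ → ℝ)) := by
  rw [Subgroup.IsArithmetic.isCusp_iff_isCusp_SL2Z, isCusp_SL2Z_iff]

/-- The product `η(z)^12 η(Nz)^12` as a cusp form for `Γ₀(N)`, `N` odd. -/
noncomputable def etaProductCuspForm {N : ℕ} [NeZero N] (hN : Odd N) :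
    CuspForm (Gamma0GL N) 12 where
  toFun := etaProduct N
  slash_action_eq' A hA := by
    obtain ⟨γ, hγ, rfl⟩ := hA
    exact etaProduct_slash hN hγ
  holo' := mdifferentiable_etaProduct
  zero_at_cusps' := isZeroAt_etaProduct

lemma etaProductCuspForm_mem_plusCuspForms {N : ℕ} [NeZero N] (hN : Odd N) :
    etaProductCuspForm hN ∈ plusCuspForms N 12 := by
  rw [plusCuspForms, Module.End.mem_eigenspace_iff, one_smul]
  ext z
  exact congrFun (etaProduct_slash_atkinLehnerMatrix N) z

lemma continuous_sq_eq_iff {N : ℕ} [NeZero N] (g : ℍ → ℂ) : (Continuous g ∧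
      ∀ z, g z ^ 2 = discriminantGamma0 N z * atkinLehner N 12 (discriminantGamma0 N) z) ↔
    (g = fun z ↦ (N : ℂ) ^ 3 * etaProduct N z) ∨
      (g = fun z ↦ -((N : ℂ) ^ 3 * etaProduct N z)) := by
  have hcont : Continuous fun z ↦ (N : ℂ) ^ 3 * etaProduct N z :=
    continuous_const.mul mdifferentiable_etaProduct.continuous
  have h0 : (N : ℂ) ≠ 0 := by exact_mod_cast NeZero.ne N
  simp only [← sq_natCast_mul_etaProduct]
  constructor
  · rintro ⟨hg, hsq⟩
    have := isPreconnected_univ.eq_or_eq_neg_of_sq_eq hg.continuousOn hcont.continuousOn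
      (fun z _ ↦ hsq z) (fun {z} _ ↦ mul_ne_zero (pow_ne_zero _ h0) (etaProduct_ne_zero z))
    rwa [Set.eqOn_univ, Set.eqOn_univ] at this
  · rintro (rfl | rfl)
    exacts [⟨hcont, fun _ ↦ rfl⟩, ⟨hcont.neg, fun z ↦ neg_sq _⟩]

/-! ### The single cusp of `X₀⁺(N)` -/

namespace X0Plus

variable {N : ℕ} [NeZero N]

lemma mk_eq_mk_iff (p q : ExtendedUpperHalfPlane) : mk N p = mk N q ↔
    ∃ g ∈ Gamma0Plus N, g • (Sum.map id (OnePoint.map ((↑) : ℚ → ℝ)) q : ℍ ⊕ OnePoint ℝ) =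
      Sum.map id (OnePoint.map ((↑) : ℚ → ℝ)) p := by
  refine (Quotient.eq (r := X0PlusSetoid N)).trans ?_
  change _ ∈ MulAction.orbit _ _ ↔ _
  simp [MulAction.mem_orbit_iff, Subgroup.smul_def]

lemma mk_inl_ne_infty (z : ℍ) : mk N (Sum.inl z) ≠ infty N := by
  rw [infty, Ne, mk_eq_mk_iff]
  rintro ⟨g, -, hg⟩
  simp at hg

lemma atkinLehnerMatrix_smul_infty : atkinLehnerMatrix N • (∞ : OnePoint ℝ) = (0 : ℝ) := by
  rw [OnePoint.smul_infty_eq_ite]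
  simp [atkinLehnerMatrix, sqrt_natCast_ne_zero N]

/-- For prime `N`, the group generated by `Γ₀(N)` and the Fricke involution acts transitively on
`ℙ¹(ℚ)`. -/
lemma mk_inr_eq_infty (hN : N.Prime) (c : OnePoint ℚ) : mk N (Sum.inr c) = infty N := by
  rw [infty, mk_eq_mk_iff]
  suffices ∃ g ∈ Gamma0Plus N, g • (∞ : OnePoint ℝ) = OnePoint.map ((↑) : ℚ → ℝ) c by
    obtain ⟨g, hg, h⟩ := this
    exact ⟨g, hg, by simp [h]⟩
  induction c using OnePoint.rec with
  | infty => exact ⟨1, one_mem _, by simp⟩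
  | coe x =>
    have hden : ((x.den : ℤ) : ℝ) ≠ 0 := by exact_mod_cast x.den_ne_zero
    have hx : (x : ℝ) = (x.num : ℝ) / (x.den : ℤ) := by
      simpa using Rat.cast_def x
    have hcop : IsCoprime x.num (x.den : ℤ) := by
      rw [Int.isCoprime_iff_nat_coprime]
      simpa using x.reduced
    by_cases hdvd : (N : ℤ) ∣ x.den
    -- Bézout completes the first column `(num, den)` to a matrix of `Γ₀(N)`, sending `∞` to `x`.
    · obtain ⟨u, v, huv⟩ := hcop
      obtain ⟨γ, hγ⟩ : ∃ γ : SL(2, ℤ), γ.1 = !![x.num, -v; x.den, u] := by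
        refine ⟨⟨!![x.num, -v; x.den, u], ?_⟩, rfl⟩
        rw [Matrix.det_fin_two]
        simp only [Matrix.of_apply, Matrix.cons_val', Matrix.cons_val_zero, Matrix.cons_val_one,
          Matrix.cons_val_fin_one]
        linear_combination huv
      have hmem : γ ∈ CongruenceSubgroup.Gamma0 N := by
        change ((γ.1 1 0 : ℤ) : ZMod N) = 0
        rw [hγ]
        exact (ZMod.intCast_zmod_eq_zero_iff_dvd _ N).2 hdvd
      refine ⟨Matrix.SpecialLinearGroup.mapGL ℝ γ,
        (le_sup_left : Gamma0GL N ≤ _) ⟨γ, hmem, rfl⟩, ?_⟩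
      rw [OnePoint.smul_infty_eq_ite]
      simp [hγ, hx]
    -- Here `(num, den)` serves as second column, with lower left entry divisible by `N`: the matrix
    -- sends `0` to `x`, and the involution sends `∞` to `0`.
    · have hcop' : IsCoprime ((N : ℤ) * x.num) (x.den : ℤ) :=
        IsCoprime.mul_left
          ((Nat.prime_iff_prime_int.1 hN).coprime_iff_not_dvd.2 hdvd) hcop
      obtain ⟨u, v, huv⟩ := hcop'
      obtain ⟨γ, hγ⟩ : ∃ γ : SL(2, ℤ), γ.1 = !![v, x.num; -(N * u), x.den] := by
        refine ⟨⟨!![v, x.num; -(N * u), x.den], ?_⟩, rfl⟩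
        rw [Matrix.det_fin_two]
        simp only [Matrix.of_apply, Matrix.cons_val', Matrix.cons_val_zero, Matrix.cons_val_one,
          Matrix.cons_val_fin_one]
        linear_combination huv
      have hmem : γ ∈ CongruenceSubgroup.Gamma0 N := by
        change ((γ.1 1 0 : ℤ) : ZMod N) = 0
        simp [hγ]
      refine ⟨Matrix.SpecialLinearGroup.mapGL ℝ γ * atkinLehnerMatrix N,
        mul_mem ((le_sup_left : Gamma0GL N ≤ _) ⟨γ, hmem, rfl⟩)
          ((le_sup_right : Subgroup.zpowers (atkinLehnerMatrix N) ≤ _)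
            (Subgroup.mem_zpowers _)), ?_⟩
      rw [mul_smul, atkinLehnerMatrix_smul_infty, OnePoint.smul_some_eq_ite]
      simp [hγ, hx]

end X0Plus

theorem mainTheorem4 (N : ℕ) [Fact N.Prime] (hN : Odd N) :
    -- `w_N(Δ)(z) = N^6 Δ(Nz) = N^6 η(Nz)^24`
    (∀ z : ℍ, atkinLehner N 12 (discriminantGamma0 N) z =
      (N : ℂ) ^ 6 * ModularForm.eta (N * z) ^ 24) ∧
    -- the continuous square roots of `Δ · w_N(Δ)` are `± N^3 η(z)^12 η(Nz)^12`
    (∀ g : ℍ → ℂ, (Continuous g ∧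
        ∀ z, g z ^ 2 = discriminantGamma0 N z * atkinLehner N 12 (discriminantGamma0 N) z) ↔
      (g = fun z ↦ (N : ℂ) ^ 3 * etaProduct N z) ∨
        (g = fun z ↦ -((N : ℂ) ^ 3 * etaProduct N z))) ∧
    -- it lies in `S_12⁺(Γ₀(N))`
    (∃ F ∈ plusCuspForms N 12, ∀ z : ℍ, F z = etaProduct N z) ∧
    -- `X₀⁺(N)` has the single cusp `∞`
    (∀ c : OnePoint ℚ, X0Plus.mk N (Sum.inr c) = X0Plus.infty N) ∧
    -- its zeros on `X₀⁺(N)` are exactly the cusp `∞`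
    (∀ p : ExtendedUpperHalfPlane,
      VanishesAt (etaProduct N) 12 p ↔ X0Plus.mk N p = X0Plus.infty N) := by
  have hp : N.Prime := Fact.out
  refine ⟨atkinLehner_discriminantGamma0_apply N, continuous_sq_eq_iff,
    ⟨etaProductCuspForm hN, etaProductCuspForm_mem_plusCuspForms hN, fun _ ↦ rfl⟩,
    X0Plus.mk_inr_eq_infty hp, ?_⟩
  rintro (z | c)
  · exact iff_of_false (etaProduct_ne_zero z) (X0Plus.mk_inl_ne_infty z)
  · exact iff_of_true (isZeroAt_etaProduct (isCusp_gamma0GL_iff.2 ⟨c, rfl⟩))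
      (X0Plus.mk_inr_eq_infty hp c)
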